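/- Let $p$ be a prime with $p \equiv 3 \pmod 4$ and let $\alpha$ be an odd positive integer, with $(p,\alpha) \neq (3,1)$. Then there does not exist a symmetric $\left(\tfrac12 p^\alpha(p^\alpha-1),\, p^\alpha,\, 2\right)$-covering whose excess is a Hamilton cycle. Here a $(v,k,\lambda)$-covering is a pair $(V,\mathcal{B})$, where $V$ is a set of $v$ points and $\mathcal{B}$ is a collection (in which repetitions are allowed) of $k$-subsets of $V$, called blocks, such that every pair of distinct points $x,y \in V$ is contained in at least $\lambda$ blocks. It is symmetric if it has exactly $v$ blocks. Its excess is the multigraph on vertex set $V$ in which distinct vertices $x$ and $y$ are joined by an edge of multiplicity $r_{xy}-\lambda$, where $r_{xy}$ is the number of blocks containing both $x$ and $y$. The excess is a Hamilton cycle if, as a multigraph, it is a single cycle passing through all the vertices in $V$. -/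

import Mathlib

/-- A loopless multigraph with vertex set `V`, given by its edge multiplicities. -/
structure LooplessMultigraph (V : Type*) where
  /-- `mult x y` is the multiplicity of the edge joining `x` and `y`. -/
  mult : V → V → ℕ
  mult_comm : ∀ x y, mult x y = mult y x
  mult_self : ∀ x, mult x x = 0

/-- The multigraph `G` is a Hamilton cycle: for some `n ≥ 2` its vertices can be listed without
repetition as `f 0, …, f (n - 1)` in such a way that the multiset of edges of `G` is
`{f 0, f 1}, {f 1, f 2}, …, {f (n - 1), f 0}`. (For `n = 2` this is a pair of parallel edges.) -/
def LooplessMultigraph.IsHamiltonCycle {V : Type*} [DecidableEq V]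
    (G : LooplessMultigraph V) : Prop :=
  ∃ n : ℕ, 2 ≤ n ∧ ∃ f : Fin n ≃ V, ∀ x y : V,
    G.mult x y = (Finset.univ.filter
      (fun i : Fin n => s(f i, f (finRotate n i)) = s(x, y))).card

/-- The number of blocks in the collection `B` (counted with repetition) that contain both
`x` and `y`. -/
def pairCount {V : Type*} [DecidableEq V] (B : Multiset (Finset V)) (x y : V) : ℕ :=
  B.countP (fun b => x ∈ b ∧ y ∈ b)

/-- A `(v, k, l)`-covering with point set `V`: a collection of `k`-subsets of the `v`-set `V`, in
which repeated blocks are allowed, such that every pair of distinct points lies in at least `l`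
blocks. -/
structure PairCovering (V : Type*) [Fintype V] [DecidableEq V] (v k l : ℕ) where
  blocks : Multiset (Finset V)
  card_points : Fintype.card V = v
  card_block : ∀ b ∈ blocks, b.card = k
  le_pairCount : ∀ x y : V, x ≠ y → l ≤ pairCount blocks x y

namespace PairCovering

/-- A covering is symmetric if it has as many blocks as points. -/
def IsSymmetric {V : Type*} [Fintype V] [DecidableEq V] {v k l : ℕ}
    (C : PairCovering V v k l) : Prop :=
  C.blocks.card = v

/-- The excess of a `(v, k, l)`-covering: distinct points `x` and `y` are joined by an edge of
multiplicity `r - l`, where `r` is the number of blocks that contain both. The subtraction does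
not truncate, by `le_pairCount`. -/
def excess {V : Type*} [Fintype V] [DecidableEq V] {v k l : ℕ}
    (C : PairCovering V v k l) : LooplessMultigraph V where
  mult x y := if x = y then 0 else pairCount C.blocks x y - l
  mult_comm x y := by simp only [pairCount, and_comm, eq_comm]
  mult_self x := by simp

end PairCovering

/-! Put k = p^α and v = k(k-1)/2 = 2h+1 = k·a. With the points listed along the cycle, the incidence
matrix N has row sums k and N Nᵀ = (k-2)I + 2J + A, where A is the adjacency matrix of the cycle.
The plan is to show that N has too large a kernel mod p.

Modulo p, N Nᵀ is a cyclic second difference plus 2J, so its kernel has dimension at most 2. The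
all-ones vector 1 lies in ker N. A second kernel vector comes from the zero-sum Chebyshev vector z,
which N Nᵀ sends to c(e_first - e_last) with c ≡ v mod p^(α+1). So y = Nᵀz has sum 0 and squared
norm k·b with b ≡ a mod p, and N y ≡ 0 mod k. Let p^j be the largest power modulo which y is
constant, and write y + c' = p^j n. As -1 is not a square mod p, the norm of y + c' forces 2j ≤ α,
so j < α. Hence N n ≡ 0 mod p, while n is not constant mod p.

Thus 1 and n span ker N mod p, and 1 is orthogonal to both. So 1 = Nᵀx for some x with N Nᵀx = 0;
but the dimensions force ker N Nᵀ = ker Nᵀ, giving 1 = 0. -/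

/-! ### The Chebyshev sequence and its p-adic estimate -/

/-- The sequence with `s 0 = 0`, `s 1 = 1` and `s (n + 1) + s (n - 1) = (2 - k) * s n`. -/
noncomputable def chebSeq (k n : ℤ) : ℤ := (Polynomial.Chebyshev.S ℤ (n - 1)).eval (2 - k)

theorem chebSeq_zero (k : ℤ) : chebSeq k 0 = 0 := by simp [chebSeq]

theorem chebSeq_one (k : ℤ) : chebSeq k 1 = 1 := by simp [chebSeq]

theorem chebSeq_neg (k n : ℤ) : chebSeq k (-n) = -chebSeq k n := by
  simp [chebSeq, Polynomial.Chebyshev.S_neg_sub_one]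

theorem chebSeq_add_one_add (k n : ℤ) :
    chebSeq k (n + 1) + chebSeq k (n - 1) = (2 - k) * chebSeq k n := by
  have h := congrArg (Polynomial.eval (2 - k)) (Polynomial.Chebyshev.S_add_one ℤ (n - 1))
  simp only [sub_add_cancel, Polynomial.eval_sub, Polynomial.eval_mul, Polynomial.eval_X] at h
  simp only [chebSeq, add_sub_cancel_right]
  linarith

theorem dvd_chebSeq_sub (k n : ℤ) : k ∣ chebSeq k n - n := by
  have h := Polynomial.sub_dvd_eval_sub (2 - k) 2 (Polynomial.Chebyshev.S ℤ (n - 1))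
  rw [Polynomial.Chebyshev.S_eval_two] at h
  have h2 : (2 - k - 2 : ℤ) = -k := by ring
  rw [h2, neg_dvd] at h
  simpa [chebSeq] using h

/-- Two uses of Pascal's rule turn the second difference in n of the j-th binomial into the (j-1)-st
one at n + 1, hence the factor -k. The bound on n kills the top term left over by this shift. -/
theorem sum_choose_recurrence (k : ℤ) (M n : ℕ) (hn : n + 1 ≤ M) :
    ∑ j ∈ Finset.range (M + 1), (-k) ^ j * ((n + 2 + j).choose (2 * j + 1) : ℤ) =
      (2 - k) * ∑ j ∈ Finset.range (M + 1), (-k) ^ j * ((n + 1 + j).choose (2 * j + 1) : ℤ) -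
        ∑ j ∈ Finset.range (M + 1), (-k) ^ j * ((n + j).choose (2 * j + 1) : ℤ) := by
  have key : ∑ j ∈ Finset.range (M + 1), (-k) ^ j * (((n + 2 + j).choose (2 * j + 1) : ℤ)
      - 2 * ((n + 1 + j).choose (2 * j + 1) : ℤ) + ((n + j).choose (2 * j + 1) : ℤ)) =
      -k * ∑ j ∈ Finset.range (M + 1), (-k) ^ j * ((n + 1 + j).choose (2 * j + 1) : ℤ) := by
    rw [Finset.sum_range_succ', Finset.sum_range_succ _ M,
      Nat.choose_eq_zero_of_lt (show n + 1 + M < 2 * M + 1 by omega), Nat.cast_zero,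
      mul_zero ((-k) ^ M), add_zero (Finset.sum _ _), Finset.mul_sum, ← add_zero (∑ j ∈ Finset.range M, -k * _)]
    congr 1
    · refine Finset.sum_congr rfl fun j _ => ?_
      have h1 : (n + 2 + (j + 1)).choose (2 * (j + 1) + 1) =
          (n + 1 + (j + 1)).choose (2 * j + 2) + (n + 1 + (j + 1)).choose (2 * (j + 1) + 1) := by
        rw [show n + 2 + (j + 1) = n + 1 + (j + 1) + 1 by ring]
        exact Nat.choose_succ_succ' _ _
      have h2 : (n + 1 + (j + 1)).choose (2 * (j + 1) + 1) =
          (n + (j + 1)).choose (2 * j + 2) + (n + (j + 1)).choose (2 * (j + 1) + 1) := by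
        rw [show n + 1 + (j + 1) = n + (j + 1) + 1 by ring]
        exact Nat.choose_succ_succ' _ _
      have h3 : (n + 1 + (j + 1)).choose (2 * j + 2) =
          (n + 1 + j).choose (2 * j + 1) + (n + (j + 1)).choose (2 * j + 2) := by
        rw [show n + (j + 1) = n + 1 + j by ring]
        exact Nat.choose_succ_succ' _ _
      rw [h1, h2, h3]
      push_cast
      ring
    · simp
      ring
  simp only [mul_add, mul_sub, Finset.sum_add_distrib, Finset.sum_sub_distrib,
    mul_left_comm _ (2 : ℤ), ← Finset.mul_sum] at key
  linarith

theorem chebSeq_eq_sum (k : ℤ) (M n : ℕ) (hn : n ≤ M + 1) :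
    chebSeq k n =
      ∑ j ∈ Finset.range (M + 1), (-k) ^ j * ((n + j).choose (2 * j + 1) : ℤ) := by
  induction n using Nat.strong_induction_on with
  | _ n ih =>
    match n with
    | 0 =>
      rw [Nat.cast_zero, chebSeq_zero, Finset.sum_eq_zero]
      intro j _
      rw [Nat.choose_eq_zero_of_lt (by omega)]
      simp
    | 1 =>
      rw [Nat.cast_one, chebSeq_one, Finset.sum_eq_single 0]
      · simp
      · intro j _ hj
        rw [Nat.choose_eq_zero_of_lt (by omega)]
        simp
      · simp
    | n + 2 =>
      have h := chebSeq_add_one_add k (n + 1 : ℕ)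
      have h1 := ih (n + 1) (by omega) (by omega)
      have h0 := ih n (by omega) (by omega)
      rw [sum_choose_recurrence k M n (by omega), ← h1, ← h0]
      have e1 : ((n + 1 : ℕ) : ℤ) + 1 = (n + 2 : ℕ) := by push_cast; ring
      have e2 : ((n + 1 : ℕ) : ℤ) - 1 = n := by push_cast; ring
      rw [e1, e2] at h
      linarith

theorem two_mul_add_one_mul_choose_add (h j : ℕ) :
    (2 * j + 1 : ℤ) * ((h + j).choose (2 * j + 1) + (h + 1 + j).choose (2 * j + 1)) =
      (2 * h + 1) * (h + j).choose (2 * j) := by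
  have e : (h + 1 + j).choose (2 * j + 1) =
      (h + j).choose (2 * j) + (h + j).choose (2 * j + 1) := by
    rw [show h + 1 + j = h + j + 1 by ring]
    exact Nat.choose_succ_succ' _ _
  rcases le_or_gt j h with hj | hj
  · have h2 := Nat.choose_succ_right_eq (h + j) (2 * j)
    rw [show h + j - 2 * j = h - j by omega] at h2
    zify [hj] at h2
    rw [e]
    push_cast
    linear_combination 2 * h2
  · rw [e, Nat.choose_eq_zero_of_lt (show h + j < 2 * j + 1 by omega),
      Nat.choose_eq_zero_of_lt (show h + j < 2 * j by omega)]
    simp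

theorem two_mul_add_one_lt_pow {q : ℕ} (hq : 5 ≤ q) {j : ℕ} (hj : 1 ≤ j) :
    2 * j + 1 < q ^ j := by
  induction j, hj using Nat.le_induction with
  | base => simpa using by omega
  | succ j _ ih =>
    rw [pow_succ]
    nlinarith

/-- Dividing by 2j+1 costs p^e with p^e ≤ 2j+1 < p^(αj), so at least one of the αj new factors p
survives. -/
theorem pow_succ_dvd_pow_mul {p α j : ℕ} (hp : p.Prime) (hq : 5 ≤ p ^ α) (hj : 1 ≤ j)
    {a v b : ℤ} (hv : (p : ℤ) ^ α ∣ v) (h : (2 * j + 1 : ℤ) * a = v * b) :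
    (p : ℤ) ^ (α + 1) ∣ ((p : ℤ) ^ α) ^ j * a := by
  obtain ⟨e, q, hqp, he⟩ :=
    Nat.exists_eq_pow_mul_and_not_dvd (show 2 * j + 1 ≠ 0 by omega) p hp.ne_one
  have hlt := two_mul_add_one_lt_pow hq hj
  rw [← pow_mul] at hlt
  have hea : e < α * j := by
    refine (Nat.pow_lt_pow_iff_right hp.one_lt).1 (lt_of_le_of_lt ?_ hlt)
    exact Nat.le_of_dvd (by omega) ⟨q, he⟩
  have hdv : (p : ℤ) ^ α ∣ q * ((p : ℤ) ^ e * a) := by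
    have : (q : ℤ) * ((p : ℤ) ^ e * a) = v * b := by
      rw [← h]
      have : (2 * j + 1 : ℤ) = (p : ℤ) ^ e * q := by exact_mod_cast he
      rw [this]
      ring
    rw [this]
    exact hv.mul_right b
  have hcop : IsCoprime ((p : ℤ) ^ α) (q : ℤ) := by
    apply IsCoprime.pow_left
    rw [Nat.isCoprime_iff_coprime]
    exact (Nat.Prime.coprime_iff_not_dvd hp).2 hqp
  have hd := hcop.dvd_of_dvd_mul_left hdv
  rw [← pow_mul, show α * j = (α * j - e - 1) + 1 + e by omega, pow_add _ _ e, mul_assoc, pow_succ,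
    pow_succ, mul_comm ((p : ℤ) ^ α), mul_assoc]
  exact (mul_dvd_mul_left _ hd).mul_left _

/-- In the binomial expansion the j = 0 term is exactly 2h+1. Each later term is (-k)^j
(2h+1)/(2j+1) times an integer. -/
theorem pow_succ_dvd_chebSeq_add_sub {p α h : ℕ} (hp : p.Prime) (hq : 5 ≤ p ^ α)
    (hv : (p : ℤ) ^ α ∣ 2 * h + 1) :
    (p : ℤ) ^ (α + 1) ∣
      chebSeq ((p : ℤ) ^ α) h + chebSeq ((p : ℤ) ^ α) (h + 1) - (2 * h + 1) := by
  have e1 := chebSeq_eq_sum ((p : ℤ) ^ α) h h (by omega)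
  have e2 := chebSeq_eq_sum ((p : ℤ) ^ α) h (h + 1) (by omega)
  push_cast at e2
  rw [e1, e2, ← Finset.sum_add_distrib, Finset.sum_range_succ']
  simp only [← mul_add]
  have : ∀ x : ℤ, x + (-(p : ℤ) ^ α) ^ 0 * (((h + 0).choose (2 * 0 + 1) : ℕ) +
      ((h + 1 + 0).choose (2 * 0 + 1) : ℕ)) - (2 * h + 1) = x := by
    intro x
    simp
    ring
  rw [this]
  refine Finset.dvd_sum fun j _ => ?_
  rw [neg_pow, mul_assoc]
  refine Dvd.dvd.mul_left ?_ _
  refine pow_succ_dvd_pow_mul hp hq (by omega) hv ?_ (b := ((h + (j + 1)).choose (2 * (j + 1)) : ℕ))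
  exact two_mul_add_one_mul_choose_add h (j + 1)

/-! ### Linear algebra over a field -/

open Matrix in
theorem gram_mulVec {R : Type*} [CommRing R] {m : ℕ} {k : R}
    {G : Matrix (Fin (m + 1)) (Fin (m + 1)) R}
    (hG : ∀ i j, G i j = (if i = j then k - 2 else 0) + 2 +
      (if j = i + 1 then 1 else 0) + (if i = j + 1 then 1 else 0))
    (x : Fin (m + 1) → R) (i : Fin (m + 1)) :
    (G *ᵥ x) i = (k - 2) * x i + 2 * ∑ j, x j + x (i + 1) + x (i - 1) := by
  have h : ∀ j, (i = j + 1) = (j = i - 1) := fun j => by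
    exact propext ⟨fun h => eq_sub_of_add_eq h.symm, fun h => (eq_sub_iff_add_eq.1 h).symm⟩
  simp only [Matrix.mulVec, dotProduct, hG, h, add_mul, Finset.sum_add_distrib, ite_mul, zero_mul,
    one_mul, Finset.sum_ite_eq, Finset.sum_ite_eq', Finset.mem_univ, if_true, Finset.mul_sum]

theorem Nat.sum_range_choose_two (n : ℕ) :
    ∑ i ∈ Finset.range n, i.choose 2 = n.choose 3 := by
  induction n with
  | zero => rfl
  | succ n ih => rw [Finset.sum_range_succ, ih, add_comm]; exact (Nat.choose_succ_succ' n 2).symm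

-- The recurrence forces x_n = -2T·C(n,2). Summing gives T = -2T·C(m+1,3) = 0.
open scoped Fin.NatCast Fin.CommRing in
theorem eq_zero_of_cyclic_second_difference {F : Type*} [Field F] {m : ℕ}
    (hF : ((m + 1).choose 3 : F) = 0) (x : Fin (m + 1) → F)
    (hx : ∀ i, -2 * x i + 2 * ∑ j, x j + x (i + 1) + x (i - 1) = 0)
    (h0 : x 0 = 0) (h1 : x 1 = 0) : x = 0 := by
  set T := ∑ j, x j with hT
  have key : ∀ n : ℕ, x (n : Fin (m + 1)) = -(2 * T) * (n.choose 2 : F) ∧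
      x ((n + 1 : ℕ) : Fin (m + 1)) = -(2 * T) * ((n + 1).choose 2 : F) := by
    intro n
    induction n with
    | zero => simp [h0, h1]
    | succ n ih =>
      refine ⟨ih.2, ?_⟩
      have h := hx ((n + 1 : ℕ) : Fin (m + 1))
      have e : (((n + 1 : ℕ) : Fin (m + 1)) - 1) = (n : Fin (m + 1)) := by push_cast; ring
      rw [e, ih.1, ih.2] at h
      have c1 : (n + 1 + 1).choose 2 = n + 1 + (n + 1).choose 2 := by
        rw [Nat.choose_succ_succ' (n + 1) 1, Nat.choose_one_right]
      have c2 : (n + 1).choose 2 = n + n.choose 2 := by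
        rw [Nat.choose_succ_succ' n 1, Nat.choose_one_right]
      rw [c2] at h
      rw [c1, c2]
      push_cast at h ⊢
      linear_combination h
  have hT0 : T = 0 := by
    have h := Fin.sum_univ_eq_sum_range (fun n : ℕ => x (n : Fin (m + 1))) (m + 1)
    simp only [Fin.cast_val_eq_self, (key _).1, ← Finset.mul_sum] at h
    rw [← Nat.cast_sum, Nat.sum_range_choose_two, hF, mul_zero] at h
    exact h
  funext i
  have h := (key i).1
  rw [Fin.cast_val_eq_self, hT0] at h
  simpa using h

open Matrix in
/-- If the kernel of `N * Nᵀ` is at most two-dimensional and `u`, `w` are linearly independent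
vectors in the kernel of `N`, then `u` is not orthogonal to both `u` and `w`. -/
theorem not_orthogonal_of_mulVec_eq_zero {F ι : Type*} [Field F] [Fintype ι] [DecidableEq ι]
    {N : Matrix ι ι F} {a b : ι}
    (hker : ∀ x, (N * Nᵀ) *ᵥ x = 0 → x a = 0 → x b = 0 → x = 0)
    {u w : ι → F} (hli : LinearIndependent F ![u, w]) (hu : N *ᵥ u = 0) (hw : N *ᵥ w = 0)
    (huu : u ⬝ᵥ u = 0) (hwu : w ⬝ᵥ u = 0) : False := by
  have hK' : Module.finrank F (LinearMap.ker (N * Nᵀ).mulVecLin) ≤ 2 := by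
    let ev : LinearMap.ker (N * Nᵀ).mulVecLin →ₗ[F] F × F :=
      ((LinearMap.proj a).prod (LinearMap.proj b)) ∘ₗ Submodule.subtype _
    have hinj : Function.Injective ev := by
      rw [injective_iff_map_eq_zero]
      rintro ⟨x, hx⟩ h
      have h2 : x a = 0 ∧ x b = 0 := by simpa [ev] using h
      exact Subtype.ext (hker x hx h2.1 h2.2)
    simpa using LinearMap.finrank_le_finrank_of_injective hinj
  have hle : LinearMap.ker Nᵀ.mulVecLin ≤ LinearMap.ker (N * Nᵀ).mulVecLin := by
    intro x hx
    have : Nᵀ *ᵥ x = 0 := hx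
    change (N * Nᵀ) *ᵥ x = 0
    rw [← Matrix.mulVec_mulVec, this, Matrix.mulVec_zero]
  have hN2 : 2 ≤ Module.finrank F (LinearMap.ker N.mulVecLin) := by
    have h1 : Module.finrank F _ = 2 := finrank_span_eq_card hli
    rw [← h1]
    refine Submodule.finrank_mono (Submodule.span_le.2 ?_)
    rintro _ ⟨i, rfl⟩
    fin_cases i
    · simpa using hu
    · simpa using hw
  have r1 := LinearMap.finrank_range_add_finrank_ker N.mulVecLin
  have r2 := LinearMap.finrank_range_add_finrank_ker Nᵀ.mulVecLin
  have r3 := Matrix.rank_transpose N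
  have r4 := LinearIndependent.rank_matrix (M := Matrix.of ![u, w]) hli
  have r5 := LinearMap.finrank_range_add_finrank_ker (Matrix.of ![u, w]).mulVecLin
  rw [Matrix.rank] at r3 r4
  rw [Matrix.rank] at r3
  rw [Fintype.card_fin] at r4
  have hmono := Submodule.finrank_mono hle
  -- N is square, so ker N and ker Nᵀ have equal dimension, squeezed to 2.
  have heq := Submodule.eq_of_le_of_finrank_le hle (by omega)
  have horth : ∀ y, N *ᵥ y = 0 → ∀ x, y ⬝ᵥ (Nᵀ *ᵥ x) = 0 := by
    intro y hy x
    rw [Matrix.dotProduct_mulVec, Matrix.vecMul_transpose, hy, zero_dotProduct]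
  have hle2 : LinearMap.range Nᵀ.mulVecLin ≤ LinearMap.ker (Matrix.of ![u, w]).mulVecLin := by
    rintro _ ⟨x, rfl⟩
    rw [LinearMap.mem_ker]
    funext i
    fin_cases i
    · exact horth u hu x
    · exact horth w hw x
  -- Both sides have dimension |ι| - 2.
  have heq2 := Submodule.eq_of_le_of_finrank_le hle2 (by omega)
  have hmem : u ∈ LinearMap.range Nᵀ.mulVecLin := by
    rw [heq2, LinearMap.mem_ker]
    funext i
    fin_cases i
    · exact huu
    · exact hwu
  obtain ⟨x, hx⟩ := hmem
  have hx' : Nᵀ *ᵥ x = u := hx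
  have : x ∈ LinearMap.ker Nᵀ.mulVecLin := by
    rw [heq]
    change (N * Nᵀ) *ᵥ x = 0
    rw [← Matrix.mulVec_mulVec, hx', hu]
  have hu0 : u = 0 := by
    rw [← hx']
    exact this
  exact hli.ne_zero 0 hu0

/-! ### The Chebyshev vector on the cycle -/

/-- The centred sequence `chebSeq k`, listed around a cycle of length `2 * h + 1`. -/
noncomputable def chebCycle (k : ℤ) (h : ℕ) (i : Fin (2 * h + 1)) : ℤ := chebSeq k ((i : ℕ) - h)

theorem sum_chebCycle (k : ℤ) (h : ℕ) : ∑ i, chebCycle k h i = 0 := by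
  have e : ∑ i, chebCycle k h i = ∑ i, -chebCycle k h i := by
    rw [← Equiv.sum_comp Fin.revPerm]
    refine Finset.sum_congr rfl fun i _ => ?_
    rw [chebCycle, chebCycle, ← chebSeq_neg, Fin.revPerm_apply, Fin.val_rev]
    congr 1
    omega
  rw [Finset.sum_neg_distrib] at e
  linarith

/-- The recurrence fails only where the cycle closes up: there s_(h+1) is replaced by s_(-h) = -s_h,
and symmetrically at the other end. -/
theorem chebCycle_recurrence (k : ℤ) (h : ℕ) (i : Fin (2 * h + 1)) :
    (k - 2) * chebCycle k h i + chebCycle k h (i + 1) + chebCycle k h (i - 1) =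
      (if i = 0 then chebSeq k h + chebSeq k (h + 1) else 0) -
        (if i = Fin.last (2 * h) then chebSeq k h + chebSeq k (h + 1) else 0) := by
  have hrec := chebSeq_add_one_add k ((i : ℕ) - h)
  have hnext : chebCycle k h (i + 1) = chebSeq k ((i : ℕ) - h + 1) -
      (if i = Fin.last (2 * h) then chebSeq k h + chebSeq k (h + 1) else 0) := by
    rw [chebCycle, Fin.val_add_one]
    split_ifs with hi
    · rw [hi, Fin.val_last]
      push_cast
      rw [show (0 - h : ℤ) = -h by ring, chebSeq_neg, show (2 * h - h + 1 : ℤ) = h + 1 by ring]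
      ring
    · push_cast
      rw [sub_zero]
      congr 1
      ring
  have hprev : chebCycle k h (i - 1) = chebSeq k ((i : ℕ) - h - 1) +
      (if i = 0 then chebSeq k h + chebSeq k (h + 1) else 0) := by
    rw [chebCycle, Fin.coe_sub_one]
    split_ifs with hi
    · rw [hi, Fin.val_zero]
      push_cast
      rw [show (0 - h - 1 : ℤ) = -(h + 1) by ring, chebSeq_neg, show (2 * h - h : ℤ) = h by ring]
      ring
    · have hi' : (i : ℕ) ≠ 0 := fun h0 => hi (Fin.ext h0)
      push_cast [show 1 ≤ (i : ℕ) by omega]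
      rw [add_zero]
      congr 1
      ring
  rw [hnext, hprev, chebCycle]
  linear_combination hrec

theorem chebCycle_zero (k : ℤ) (h : ℕ) : chebCycle k h 0 = -chebSeq k h := by
  rw [chebCycle, ← chebSeq_neg]
  simp

theorem chebCycle_last (k : ℤ) (h : ℕ) : chebCycle k h (Fin.last (2 * h)) = chebSeq k h := by
  rw [chebCycle, Fin.val_last]
  push_cast
  congr 1
  ring

/-- A vector of the integral lattice that is orthogonal to the all-ones vector, whose norm is
exactly divisible by `p ^ α`, and that `N` maps into the multiples of `p ^ α`. -/
theorem exists_orthogonal_vector {p α h : ℕ} (hp : p.Prime) (hα : 0 < α)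
    (hq : 5 ≤ p ^ α) {a : ℤ}
    (hv : (2 * h + 1 : ℤ) = (p : ℤ) ^ α * a)
    {N : Matrix (Fin (2 * h + 1)) (Fin (2 * h + 1)) ℤ}
    (hr : N.mulVec 1 = fun _ => (p : ℤ) ^ α)
    (hG : ∀ i j, (N * N.transpose) i j = (if i = j then (p : ℤ) ^ α - 2 else 0) + 2 +
      (if j = i + 1 then 1 else 0) + (if i = j + 1 then 1 else 0)) :
    ∃ (y : Fin (2 * h + 1) → ℤ) (b : ℤ), ∑ i, y i = 0 ∧ ∑ i, y i ^ 2 = (p : ℤ) ^ α * b ∧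
      (p : ℤ) ∣ b - a ∧ ∀ i, (p : ℤ) ^ α ∣ N.mulVec y i := by
  set k : ℤ := (p : ℤ) ^ α with hk
  have hpk : (p : ℤ) ∣ k := dvd_pow_self _ hα.ne'
  obtain ⟨t, ht⟩ := pow_succ_dvd_chebSeq_add_sub (h := h) hp hq ⟨a, hv⟩
  rw [← hk] at ht
  obtain ⟨r, hr'⟩ := dvd_chebSeq_sub k h
  set z := chebCycle k h with hz
  set c := chebSeq k h + chebSeq k (h + 1) with hc
  have hck : c = k * (a + p * t) := by
    rw [pow_succ, ← hk] at ht
    linear_combination ht + hv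
  have hNy : ∀ i, N.mulVec (N.transpose.mulVec z) i =
      (if i = 0 then c else 0) - (if i = Fin.last (2 * h) then c else 0) := by
    intro i
    rw [Matrix.mulVec_mulVec, gram_mulVec hG, hz, sum_chebCycle, hc,
      ← chebCycle_recurrence k h i]
    ring
  -- The squared norm is zᵀN Nᵀz = c(z_first - z_last) = -2c·s_h, with c = k(a + pt).
  refine ⟨N.transpose.mulVec z, -2 * (a + p * t) * chebSeq k h, ?_, ?_, ?_, ?_⟩
  · have h1 : (1 : Fin (2 * h + 1) → ℤ) ⬝ᵥ N.transpose.mulVec z = 0 := by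
      rw [Matrix.dotProduct_mulVec, Matrix.vecMul_transpose, hr]
      simp only [dotProduct]
      rw [← Finset.mul_sum, hz, sum_chebCycle, mul_zero]
    simpa [dotProduct] using h1
  · have h1 : N.transpose.mulVec z ⬝ᵥ N.transpose.mulVec z =
        ∑ i, N.mulVec (N.transpose.mulVec z) i * z i := by
      rw [Matrix.dotProduct_mulVec, Matrix.vecMul_transpose]
      rfl
    have h2 : ∑ i, (N.transpose.mulVec z i) ^ 2 =
        N.transpose.mulVec z ⬝ᵥ N.transpose.mulVec z := by
      simp only [dotProduct, sq]
    rw [h2, h1]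
    simp only [hNy, sub_mul, ite_mul, zero_mul, Finset.sum_sub_distrib, Finset.sum_ite_eq',
      Finset.mem_univ, if_true]
    rw [hz, chebCycle_zero, chebCycle_last, hck]
    ring
  -- Modulo p, s_h ≡ h and 2h ≡ -1, so b ≡ -2ah ≡ a.
  · obtain ⟨q, hq'⟩ := hpk
    refine ⟨-2 * (a + p * t) * q * r - 2 * t * h - a * q * a, ?_⟩
    have e1 : chebSeq k h = h + p * q * r := by linear_combination hr' + r * hq'
    rw [e1]
    rw [hq'] at hv
    linear_combination (-a) * hv
  · intro i
    rw [hNy, hck]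
    split_ifs <;> simp

/-! ### The contradiction modulo p -/

/-- The squared norm of y + c is p^α(b + ac²), and b + ac² ≡ a(1 + c²) is nonzero mod p because p ≡
3 mod 4. -/
theorem two_mul_le_of_forall_pow_dvd {p α j : ℕ} (hp : p.Prime) (hp4 : p % 4 = 3) {ι : Type*}
    [Fintype ι] {a b c : ℤ} {y : ι → ℤ} (ha : ¬ (p : ℤ) ∣ a)
    (hcard : (Fintype.card ι : ℤ) = (p : ℤ) ^ α * a) (hy : ∑ i, y i = 0)
    (hyy : ∑ i, y i ^ 2 = (p : ℤ) ^ α * b) (hab : (p : ℤ) ∣ b - a)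
    (hj : ∀ i, (p : ℤ) ^ j ∣ y i + c) : 2 * j ≤ α := by
  have := Fact.mk hp
  have hsum : ∑ i, (y i + c) ^ 2 = (p : ℤ) ^ α * (b + a * c ^ 2) := by
    simp only [add_sq, Finset.sum_add_distrib, hyy, Finset.sum_const, Finset.card_univ,
      nsmul_eq_mul, hcard, ← Finset.sum_mul, ← Finset.mul_sum, hy]
    ring
  have hd : ((p : ℤ) ^ j) ^ 2 ∣ (p : ℤ) ^ α * (b + a * c ^ 2) := by
    rw [← hsum]
    exact Finset.dvd_sum fun i _ => pow_dvd_pow_of_dvd (hj i) 2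
  by_contra hlt
  rw [← pow_mul] at hd
  have h1 : (p : ℤ) ^ α * p ∣ (p : ℤ) ^ α * (b + a * c ^ 2) :=
    (pow_succ (p : ℤ) α ▸ pow_dvd_pow (p : ℤ) (show α + 1 ≤ j * 2 by omega)).trans hd
  have h2 := Int.dvd_of_mul_dvd_mul_left (pow_ne_zero α (by exact_mod_cast hp.ne_zero)) h1
  have h3 : (p : ℤ) ∣ a * (1 + c ^ 2) := by
    have := dvd_sub h2 hab
    rwa [show b + a * c ^ 2 - (b - a) = a * (1 + c ^ 2) by ring] at this
  rcases (Nat.prime_iff_prime_int.1 hp).dvd_or_dvd h3 with h4 | h4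
  · exact ha h4
  · refine (ZMod.exists_sq_eq_neg_one_iff (p := p)).1 ⟨(c : ZMod p), ?_⟩ hp4
    have := (ZMod.intCast_zmod_eq_zero_iff_dvd _ p).2 h4
    push_cast at this
    linear_combination -this

theorem not_exists_cyclic_gram {p α h : ℕ} (hp : p.Prime) (hp4 : p % 4 = 3) (hα : 0 < α)
    (hq : 5 ≤ p ^ α) {a : ℤ} (ha : 2 * a = (p : ℤ) ^ α - 1) (hv : (2 * h + 1 : ℤ) = (p : ℤ) ^ α * a)
    {N : Matrix (Fin (2 * h + 1)) (Fin (2 * h + 1)) ℤ}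
    (hr : N.mulVec 1 = fun _ => (p : ℤ) ^ α)
    (hG : ∀ i j, (N * N.transpose) i j = (if i = j then (p : ℤ) ^ α - 2 else 0) + 2 +
      (if j = i + 1 then 1 else 0) + (if i = j + 1 then 1 else 0)) : False := by
  have := Fact.mk hp
  obtain ⟨y, b, hy, hyy, hab, hNy⟩ := exists_orthogonal_vector hp hα hq hv hr hG
  have hpα : (p : ℤ) ∣ (p : ℤ) ^ α := dvd_pow_self _ hα.ne'
  have hpa : ¬ (p : ℤ) ∣ a := by
    intro hd
    have h1 : (p : ℤ) ∣ 1 := by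
      have := dvd_sub hpα (ha ▸ hd.mul_left 2)
      simpa using this
    exact (Nat.prime_iff_prime_int.1 hp).not_isUnit (isUnit_of_dvd_one h1)
  have hcard : (Fintype.card (Fin (2 * h + 1)) : ℤ) = (p : ℤ) ^ α * a := by
    rw [Fintype.card_fin]
    exact_mod_cast hv
  have hbound : ∀ j, (∃ c, ∀ i, (p : ℤ) ^ j ∣ y i + c) → 2 * j ≤ α := fun j ⟨c, hc⟩ =>
    two_mul_le_of_forall_pow_dvd hp hp4 hpa hcard hy hyy hab hc
  obtain ⟨j, ⟨c, hc⟩, hmax⟩ : ∃ j, (∃ c, ∀ i, (p : ℤ) ^ j ∣ y i + c) ∧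
      ¬ ∃ c, ∀ i, (p : ℤ) ^ (j + 1) ∣ y i + c := by
    by_contra! hcon
    have hall : ∀ j, ∃ c, ∀ i, (p : ℤ) ^ j ∣ y i + c := by
      intro j
      induction j with
      | zero => exact ⟨0, fun i => by simp⟩
      | succ j ih => exact hcon j ih
    have := hbound (α + 1) (hall _)
    omega
  have hjα : j < α := by
    have := hbound j ⟨c, hc⟩
    omega
  choose n hn using hc
  have hp0 : (p : ℤ) ^ j ≠ 0 := pow_ne_zero j (by exact_mod_cast hp.ne_zero)
  have hcancel : ∀ x : ℤ, (p : ℤ) ^ α ∣ (p : ℤ) ^ j * x → ((x : ℤ) : ZMod p) = 0 := by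
    intro x hx
    rw [ZMod.intCast_zmod_eq_zero_iff_dvd]
    refine Int.dvd_of_mul_dvd_mul_left hp0 ((Dvd.dvd.trans ?_ hx))
    rw [← pow_succ]
    exact pow_dvd_pow _ hjα
  have hpz : ((p : ℤ) ^ α : ZMod p) = 0 := by
    push_cast
    rw [CharP.cast_eq_zero, zero_pow hα.ne']
  have hvz : ((2 * h + 1 : ℤ) : ZMod p) = 0 := by
    rw [ZMod.intCast_zmod_eq_zero_iff_dvd, hv]
    exact hpα.mul_right a
  have hker : ∀ x, (N.map (Int.cast : ℤ → ZMod p) * (N.map (Int.cast : ℤ → ZMod p)).transpose).mulVec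
      x = 0 → x 0 = 0 → x 1 = 0 → x = 0 := by
    intro x hx
    refine eq_zero_of_cyclic_second_difference ?_ x fun i => ?_
    · have h1 := Nat.add_one_mul_choose_eq (2 * h) 2
      zify at h1
      -- This also covers p = 3, where the denominator 3 of C(v,3) is not invertible.
      have h2 := pow_succ_dvd_pow_mul hp hq le_rfl ⟨a, hv⟩
        (show (2 * (1 : ℕ) + 1 : ℤ) * ((2 * h + 1).choose 3 : ℕ) = (2 * h + 1) * ((2 * h).choose 2 : ℕ)
          by push_cast; linarith)
      rw [pow_one, pow_succ] at h2
      have h3 := Int.dvd_of_mul_dvd_mul_left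
        (pow_ne_zero α (by exact_mod_cast hp.ne_zero)) h2
      have h4 := (ZMod.intCast_zmod_eq_zero_iff_dvd _ p).2 h3
      exact_mod_cast h4
    · have hG' : ∀ i j, (N.map (Int.cast : ℤ → ZMod p) *
          (N.map (Int.cast : ℤ → ZMod p)).transpose) i j =
          (if i = j then (0 : ZMod p) - 2 else 0) + 2 +
            (if j = i + 1 then 1 else 0) + (if i = j + 1 then 1 else 0) := by
        intro i j
        have h1 := congrArg (Int.cast : ℤ → ZMod p) (hG i j)
        rw [Matrix.mul_apply] at h1 ⊢
        push_cast at h1 hpz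
        rw [hpz] at h1
        exact h1
      have h1 := gram_mulVec hG' x i
      rw [hx] at h1
      rw [Pi.zero_apply, zero_sub] at h1
      exact h1.symm
  have hmap : ∀ x : Fin (2 * h + 1) → ℤ, (∀ i, ((N.mulVec x i : ℤ) : ZMod p) = 0) →
      (N.map (Int.cast : ℤ → ZMod p)).mulVec (fun i => (x i : ZMod p)) = 0 := by
    intro x hx
    funext i
    have h1 := hx i
    simp only [Matrix.mulVec, dotProduct, Int.cast_sum, Int.cast_mul] at h1
    exact h1
  refine not_orthogonal_of_mulVec_eq_zero hker
    (u := fun i => (((1 : Fin (2 * h + 1) → ℤ) i : ℤ) : ZMod p)) (w := fun i => (n i : ZMod p))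
    ?_ ?_ ?_ ?_ ?_
  · rw [LinearIndependent.pair_iff]
    intro s t hst
    have h1 : ∀ i, s + t * (n i : ZMod p) = 0 := fun i => by simpa using congrFun hst i
    have ht : t = 0 := by
      by_contra ht
      -- If n were constant mod p, shifting c would make y constant mod p^(j+1).
      refine hmax ⟨c - (p : ℤ) ^ j * n 0, fun i => ?_⟩
      have h2 : ((n i - n 0 : ℤ) : ZMod p) = 0 := by
        have := mul_left_cancel₀ ht (add_left_cancel ((h1 i).trans (h1 0).symm))
        push_cast
        rw [this, sub_self]
      rw [ZMod.intCast_zmod_eq_zero_iff_dvd] at h2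
      rw [show y i + (c - (p : ℤ) ^ j * n 0) = (p : ℤ) ^ j * (n i - n 0) by
        linear_combination hn i, pow_succ]
      exact mul_dvd_mul_left _ h2
    have := h1 0
    rw [ht, zero_mul, add_zero] at this
    exact ⟨this, ht⟩
  · refine hmap _ fun i => ?_
    rw [hr]
    exact_mod_cast hpz
  · refine hmap _ fun i => hcancel _ ?_
    have h1 : (p : ℤ) ^ j * N.mulVec n i = N.mulVec y i + c * (p : ℤ) ^ α := by
      have h2 : (p : ℤ) ^ j • n = y + c • (1 : Fin (2 * h + 1) → ℤ) := by
        funext i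
        simp [← hn i]
      have h3 := congrFun (congrArg N.mulVec h2) i
      rw [Matrix.mulVec_add, Matrix.mulVec_smul, Matrix.mulVec_smul, hr] at h3
      simpa using h3
    rw [h1]
    exact dvd_add (hNy i) (dvd_mul_left _ _)
  · have : ((2 * h + 1 : ℕ) : ZMod p) = 0 := by exact_mod_cast hvz
    simpa [dotProduct] using this
  · have h1 : (p : ℤ) ^ j * ∑ i, n i = (p : ℤ) ^ α * (a * c) := by
      rw [Finset.mul_sum]
      simp only [← hn]
      rw [Finset.sum_add_distrib, hy, Finset.sum_const, Finset.card_univ, nsmul_eq_mul, hcard]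
      ring
    have h2 := hcancel _ ⟨_, h1⟩
    simpa [dotProduct] using h2

/-! ### From coverings to incidence matrices -/

theorem Multiset.exists_eq_map_fin {X : Type*} {n : ℕ} (s : Multiset X) (h : s.card = n) :
    ∃ B : Fin n → X, s = (Finset.univ : Finset (Fin n)).val.map B := by
  subst h
  induction s using Quotient.inductionOn with
  | _ l => exact ⟨l.get, ((Fin.univ_val_map l.get).trans
      (congrArg (fun t : List X => (t : Multiset X)) (List.ofFn_get l))).symm⟩

theorem pairCount_map_fin {V : Type*} [DecidableEq V] {n : ℕ} (B : Fin n → Finset V) (x y : V) :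
    (pairCount ((Finset.univ : Finset (Fin n)).val.map B) x y : ℤ) =
      ∑ l, (if x ∈ B l then 1 else 0) * (if y ∈ B l then 1 else 0) := by
  rw [pairCount, Multiset.countP_map]
  simp only [ite_mul, one_mul, zero_mul, ← ite_and]
  rw [Finset.sum_boole]
  rfl

theorem card_filter_cyclic_edge {V : Type*} [DecidableEq V] {m : ℕ} (f : Fin (m + 1) ≃ V)
    {i j : Fin (m + 1)} (hij : i ≠ j) :
    (Finset.univ.filter
      (fun l : Fin (m + 1) => s(f l, f (finRotate (m + 1) l)) = s(f i, f j))).card =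
      (if j = i + 1 then 1 else 0) + (if i = j + 1 then 1 else 0) := by
  have h1 : ∀ l : Fin (m + 1), (s(f l, f (finRotate (m + 1) l)) = s(f i, f j)) ↔
      ((l = i ∧ j = i + 1) ∨ (l = j ∧ i = j + 1)) := by
    intro l
    rw [Sym2.eq_iff, finRotate_apply]
    simp only [EmbeddingLike.apply_eq_iff_eq]
    constructor
    · rintro (⟨rfl, rfl⟩ | ⟨rfl, rfl⟩) <;> simp
    · rintro (⟨rfl, h⟩ | ⟨rfl, h⟩)
      · exact Or.inl ⟨rfl, h.symm⟩
      · exact Or.inr ⟨rfl, h.symm⟩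
  simp only [h1]
  rw [Finset.filter_or, Finset.card_union_of_disjoint]
  · congr 1 <;> split_ifs with h <;> simp [h, Finset.filter_eq']
  · rw [Finset.disjoint_filter]
    rintro l _ ⟨h, _⟩ ⟨h', _⟩
    exact hij (h.symm.trans h')

namespace PairCovering

variable {V : Type*} [Fintype V] [DecidableEq V] {v k : ℕ}

/-- The incidence matrix of a symmetric covering with Hamilton cycle excess, its points listed
along the cycle, satisfies the Gram equation of the covering. -/
theorem exists_incidence_matrix {h : ℕ} (C : PairCovering V v k 2) (hv : v = 2 * h + 1)
    (hk : v * 2 = k * (k - 1)) (hC : C.IsSymmetric) (hH : C.excess.IsHamiltonCycle) :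
    ∃ N : Matrix (Fin (2 * h + 1)) (Fin (2 * h + 1)) ℤ, (N.mulVec 1 = fun _ => (k : ℤ)) ∧
      ∀ i j, (N * N.transpose) i j = (if i = j then (k : ℤ) - 2 else 0) + 2 +
        (if j = i + 1 then 1 else 0) + (if i = j + 1 then 1 else 0) := by
  obtain ⟨n, hn2, f, hf⟩ := hH
  obtain rfl : n = 2 * h + 1 := by
    rw [← hv, ← C.card_points, ← Fintype.card_congr f, Fintype.card_fin]
  obtain ⟨B, hB⟩ := Multiset.exists_eq_map_fin C.blocks (hC.trans hv)
  set N : Matrix (Fin (2 * h + 1)) (Fin (2 * h + 1)) ℤ :=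
    Matrix.of fun i l => if f i ∈ B l then 1 else 0 with hN
  have hpair : ∀ i j, (N * N.transpose) i j = (pairCount C.blocks (f i) (f j) : ℤ) := by
    intro i j
    rw [hB, pairCount_map_fin, Matrix.mul_apply]
    rfl
  have hrow : ∀ i, N.mulVec 1 i = (N * N.transpose) i i := by
    intro i
    rw [Matrix.mul_apply, Matrix.mulVec, dotProduct]
    refine Finset.sum_congr rfl fun l _ => ?_
    simp only [hN, Matrix.transpose_apply, Matrix.of_apply, Pi.one_apply]
    split_ifs <;> rfl
  have hcol : ∀ l, ∑ j, N j l = k := by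
    intro l
    have hmem : B l ∈ C.blocks := by
      rw [hB]
      exact Multiset.mem_map_of_mem _ (Finset.mem_univ l)
    rw [← C.card_block _ hmem]
    simp only [hN, Matrix.of_apply]
    rw [Equiv.sum_comp f (fun x => if x ∈ B l then (1 : ℤ) else 0)]
    simp
  have hone : ∀ i : Fin (2 * h + 1), i ≠ i + 1 := by
    intro i hi
    have h1 : (1 : Fin (2 * h + 1)) = 0 := left_eq_add.1 hi
    have h2 := congrArg Fin.val h1
    rw [Fin.val_zero, Fin.val_one', Nat.mod_eq_of_lt (by omega)] at h2
    omega
  have hgram : ∀ i j, (N * N.transpose) i j =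
      (if i = j then (N * N.transpose) i i - 2 else 0) + 2 +
        (if j = i + 1 then 1 else 0) + (if i = j + 1 then 1 else 0) := by
    intro i j
    rcases eq_or_ne i j with rfl | hij
    · simp only [if_true, if_neg (hone i)]
      ring
    · have hne : f i ≠ f j := fun h0 => hij (f.injective h0)
      have h1 := hf (f i) (f j)
      rw [card_filter_cyclic_edge f hij] at h1
      have h2 : C.excess.mult (f i) (f j) = pairCount C.blocks (f i) (f j) - 2 := if_neg hne
      have h3 := C.le_pairCount _ _ hne
      rw [h2] at h1
      have h4 : pairCount C.blocks (f i) (f j) =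
          2 + (if j = i + 1 then 1 else 0) + (if i = j + 1 then 1 else 0) := by omega
      rw [hpair, h4, if_neg hij]
      push_cast
      ring
  -- Let r be the number of blocks through a point. Counting incidences in these blocks gives kr = r
  -- + 2v, since the excess has degree 2; then 2v = k(k-1) yields r = k.
  have hdiag : ∀ i, (N * N.transpose) i i = k := by
    intro i
    have h1 : ∑ j, (N * N.transpose) i j = k * (N * N.transpose) i i := by
      rw [← hrow]
      simp only [Matrix.mul_apply, Matrix.mulVec, dotProduct, Pi.one_apply, mul_one]
      rw [Finset.sum_comm, Finset.mul_sum]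
      refine Finset.sum_congr rfl fun l _ => ?_
      rw [← Finset.mul_sum, mul_comm]
      congr 1
      exact hcol l
    have h2 : ∑ j, (N * N.transpose) i j = (N * N.transpose) i i + 2 * (2 * h + 1) := by
      have e : ∀ j, (i = j + 1) = (j = i - 1) := fun j =>
        propext ⟨fun h => eq_sub_of_add_eq h.symm, fun h => (eq_sub_iff_add_eq.1 h).symm⟩
      rw [Finset.sum_congr rfl fun j _ => hgram i j]
      simp only [e, Finset.sum_add_distrib, Finset.sum_ite_eq, Finset.sum_ite_eq',
        Finset.mem_univ, if_true, Finset.sum_const, Finset.card_univ, Fintype.card_fin]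
      ring
    have hk1 : 1 < k := by
      by_contra hlt
      have : k * (k - 1) = 0 := by
        rw [show k - 1 = 0 by omega, mul_zero]
      omega
    rw [hv] at hk
    zify [hk1.le] at hk
    have h3 : ((k : ℤ) - 1) * ((N * N.transpose) i i - k) = 0 := by
      linear_combination h2 - h1 + hk
    rcases mul_eq_zero.1 h3 with h4 | h4
    · have : (1 : ℤ) < k := by exact_mod_cast hk1
      omega
    · omega
  refine ⟨N, funext fun i => (hrow i).trans (hdiag i), fun i j => ?_⟩
  rw [hgram, hdiag]

end PairCovering

theorem mainTheorem11 (p α : ℕ) (hp : p.Prime) (hp4 : p ≡ 3 [MOD 4]) (hα : Odd α)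
    (hne : (p, α) ≠ (3, 1)) (V : Type*) [Fintype V] [DecidableEq V] :
    ¬ ∃ C : PairCovering V (p ^ α * (p ^ α - 1) / 2) (p ^ α) 2,
      C.IsSymmetric ∧ C.excess.IsHamiltonCycle := by
  rintro ⟨C, hC, hH⟩
  have hp3 : p % 4 = 3 := hp4
  have hα0 : 0 < α := hα.pos
  -- Odd α enters here: it makes (k-1)/2 odd, hence v odd, so the cycle has a centre for z.
  have hk4 : p ^ α % 4 = 3 := by
    obtain ⟨t, rfl⟩ := hα
    rw [pow_succ, pow_mul, Nat.mul_mod, Nat.pow_mod, Nat.pow_mod p 2, hp3]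
    norm_num
  have hq : 5 ≤ p ^ α := by
    have h1 : p ≤ p ^ α := Nat.le_self_pow hα0.ne' p
    rcases le_or_gt 5 p with h5 | h5
    · omega
    · obtain rfl : p = 3 := by omega
      have hα1 : α ≠ 1 := fun h0 => hne (by rw [h0])
      have : 3 ^ 2 ≤ 3 ^ α := Nat.pow_le_pow_right (by norm_num) (by omega)
      omega
  obtain ⟨b, hb⟩ : ∃ b, p ^ α = 4 * b + 3 := ⟨p ^ α / 4, by omega⟩
  have ha : p ^ α - 1 = 2 * (2 * b + 1) := by omega
  have hv2 : p ^ α * (p ^ α - 1) / 2 = p ^ α * (2 * b + 1) := by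
    rw [ha, mul_left_comm, Nat.mul_div_cancel_left _ two_pos]
  obtain ⟨h, hh⟩ : ∃ h, p ^ α * (2 * b + 1) = 2 * h + 1 := by
    have h1 : Odd (p ^ α * (2 * b + 1)) :=
      Nat.odd_mul.2 ⟨⟨2 * b + 1, by omega⟩, ⟨b, rfl⟩⟩
    exact h1
  obtain ⟨N, hr, hG⟩ := C.exists_incidence_matrix (hv2.trans hh)
    (by rw [hv2, ha]; ring) hC hH
  push_cast at hr hG
  refine not_exists_cyclic_gram hp hp3 hα0 hq (a := 2 * b + 1) ?_ ?_ hr hG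
  · have : (p : ℤ) ^ α = 4 * b + 3 := by exact_mod_cast hb
    rw [this]
    ring
  · exact_mod_cast hh.symm
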